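/- **Theorem 3.** Let $R$ be a commutative ring, let $a,b_1,b_2,c\in R$, and let $k\ge 5$ be an integer. Let $G=G^{2,k}(x,a,b_1,b_2,c)\in R[[x]]$ be the unique formal power series satisfying $$G=\frac{a}{1+b_1x+b_2x^2+c\,x^k\,G}.$$ For a power series $A=\sum_{n\ge0}a_nx^n$ put $H_n(A)=\det(a_{i+j})_{0\le i,j\le n-1}$, with $H_0(A)=1$. Then for every integer $n\ge 0$: \begin{align*} H_{kn}(G)&=\mu_1\,a^{kn(n-1)+(2k-1)n}\,c^{kn(n-1)+(k-1)n},\\ H_{kn+1}(G)&=\lambda_1\,a^{kn(n+1)+n+1}\,c^{kn(n+1)-(k-1)n},\\ H_{kn+2}(G)&=\lambda_2\,(n+1)\,b_2\,a^{kn(n+1)+3n+2}\,c^{kn(n+1)-(k-3)n},\\ H_{kn+3}(G)&=\cdots=H_{kn+k-2}(G)=0,\\ H_{kn+k-1}(G)&=\mu_2\,(n+1)\,b_2\,a^{kn(n+1)+(2k-3)n+(2k-4)}\,c^{kn(n+1)+(k-3)n+(k-3)}, \end{align*} where the signs are as follows. - If $k\equiv 0$ or $1\pmod 4$, then $\lambda_1=-\lambda_2=\mu_1=\mu_2=1$.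 - If $k\equiv 2\pmod 4$, then $\lambda_1=-\lambda_2=\mu_1=(-1)^n$ and $\mu_2=(-1)^{n+k+1}$. - If $k\equiv 3\pmod 4$, then $\lambda_1=-\lambda_2=\mu_1=(-1)^n$ and $\mu_2=(-1)^{n+k}$. -/

import Mathlib

/-- The Hankel determinant `H_n(A) = det (a_{i+j})_{0 ≤ i, j ≤ n-1}` of a formal power series
`A = ∑ a_n x^n`; for `n = 0` it is the determinant of the empty matrix, which is `1`. -/
noncomputable def hankelDet {R : Type*} [CommRing R] (A : PowerSeries R) (n : ℕ) : R :=
  Matrix.det (Matrix.of fun i j : Fin n => PowerSeries.coeff ((i : ℕ) + (j : ℕ)) A)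

/-- The denominator `1 + b₁ x + b₂ x² + c x^k G`. -/
noncomputable def pathDenom {R : Type*} [CommRing R] (k : ℕ) (b₁ b₂ c : R)
    (G : PowerSeries R) : PowerSeries R :=
  1 + PowerSeries.C b₁ * PowerSeries.X + PowerSeries.C b₂ * PowerSeries.X ^ 2
    + PowerSeries.C c * PowerSeries.X ^ k * G

/-- The quotient `a / (1 + b₁ x + b₂ x² + c x^k G)`. For `k ≥ 1` the denominator has constant
term `1`, and `PowerSeries.invOfUnit _ 1` is its multiplicative inverse. -/
noncomputable def pathMap {R : Type*} [CommRing R] (k : ℕ) (a b₁ b₂ c : R)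
    (G : PowerSeries R) : PowerSeries R :=
  PowerSeries.C a * PowerSeries.invOfUnit (pathDenom k b₁ b₂ c G) 1

/-- `G` is the generating function `G^{2,k}(x, a, b₁, b₂, c)`: it satisfies
`G = a / (1 + b₁ x + b₂ x² + c x^k G)`. -/
def IsPathGF {R : Type*} [CommRing R] (k : ℕ) (a b₁ b₂ c : R) (G : PowerSeries R) : Prop :=
  G = pathMap k a b₁ b₂ c G

theorem pathDenom_mul_inv {R : Type*} [CommRing R] (k : ℕ) (hk : 1 ≤ k) (b₁ b₂ c : R)
    (G : PowerSeries R) :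
    pathDenom k b₁ b₂ c G * PowerSeries.invOfUnit (pathDenom k b₁ b₂ c G) 1 = 1 := by
  apply PowerSeries.mul_invOfUnit
  simp [pathDenom, show k ≠ 0 by omega]

/-- The defining equation in the form without division. -/
theorem isPathGF_iff {R : Type*} [CommRing R] (k : ℕ) (hk : 1 ≤ k) (a b₁ b₂ c : R)
    (G : PowerSeries R) :
    IsPathGF k a b₁ b₂ c G ↔ G * pathDenom k b₁ b₂ c G = PowerSeries.C a := by
  have h := pathDenom_mul_inv k hk b₁ b₂ c G
  unfold IsPathGF pathMap
  constructor
  · intro hG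
    calc G * pathDenom k b₁ b₂ c G
        = PowerSeries.C a * PowerSeries.invOfUnit (pathDenom k b₁ b₂ c G) 1
            * pathDenom k b₁ b₂ c G := by rw [← hG]
      _ = PowerSeries.C a * (pathDenom k b₁ b₂ c G
            * PowerSeries.invOfUnit (pathDenom k b₁ b₂ c G) 1) := by ring
      _ = PowerSeries.C a := by rw [h, mul_one]
  · intro hG
    rw [← hG, mul_assoc, h, mul_one]

theorem pathMap_contract {R : Type*} [CommRing R] (k : ℕ) (hk : 1 ≤ k) (a b₁ b₂ c : R)
    (G G' : PowerSeries R) (m : ℕ) (h : (PowerSeries.X : PowerSeries R) ^ m ∣ G - G') :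
    (PowerSeries.X : PowerSeries R) ^ (m + 1) ∣
      pathMap k a b₁ b₂ c G - pathMap k a b₁ b₂ c G' := by
  have h1 := pathDenom_mul_inv k hk b₁ b₂ c G
  have h2 := pathDenom_mul_inv k hk b₁ b₂ c G'
  obtain ⟨T, hT⟩ := h
  have hD : pathDenom k b₁ b₂ c G - pathDenom k b₁ b₂ c G'
      = PowerSeries.C c * PowerSeries.X ^ k * (PowerSeries.X ^ m * T) := by
    rw [← hT]; unfold pathDenom; ring
  unfold pathMap
  set D := pathDenom k b₁ b₂ c G
  set D' := pathDenom k b₁ b₂ c G'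
  set I := PowerSeries.invOfUnit D 1
  set I' := PowerSeries.invOfUnit D' 1
  have key : PowerSeries.C a * I - PowerSeries.C a * I'
      = -(PowerSeries.C a * I * I' * (D - D')) := by
    linear_combination (-(PowerSeries.C a * I)) * h2 + (PowerSeries.C a * I') * h1
  obtain ⟨l, rfl⟩ : ∃ l, k = l + 1 := ⟨k - 1, by omega⟩
  rw [key, hD]
  refine ⟨-(PowerSeries.C a * I * I' * PowerSeries.C c * PowerSeries.X ^ l * T), ?_⟩
  ring

/-- For `k ≥ 1` the equation `G = a / (1 + b₁ x + b₂ x² + c x^k G)` has exactly one solution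
among the formal power series. -/
theorem existsUnique_isPathGF {R : Type*} [CommRing R] (k : ℕ) (hk : 1 ≤ k) (a b₁ b₂ c : R) :
    ∃! G : PowerSeries R, IsPathGF k a b₁ b₂ c G := by
  have hc := pathMap_contract k hk a b₁ b₂ c
  have ext0 : ∀ P Q : PowerSeries R,
      (∀ n : ℕ, (PowerSeries.X : PowerSeries R) ^ n ∣ P - Q) → P = Q := by
    intro P Q h
    ext n
    have := (PowerSeries.X_pow_dvd_iff.mp (h (n + 1))) n (Nat.lt_succ_self n)
    rw [map_sub, sub_eq_zero] at this
    exact this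
  have hstep : ∀ n m : ℕ, n ≤ m → (PowerSeries.X : PowerSeries R) ^ n ∣
      (pathMap k a b₁ b₂ c)^[m] 0 - (pathMap k a b₁ b₂ c)^[n] 0 := by
    intro n
    induction n with
    | zero => intro m _; simp
    | succ n ih =>
      intro m hm
      obtain ⟨l, rfl⟩ : ∃ l, m = l + 1 := ⟨m - 1, by omega⟩
      rw [Function.iterate_succ_apply', Function.iterate_succ_apply']
      exact hc _ _ _ (ih l (by omega))
  let G : PowerSeries R :=
    PowerSeries.mk fun n => PowerSeries.coeff n ((pathMap k a b₁ b₂ c)^[n + 1] 0)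
  have hG : ∀ n : ℕ, (PowerSeries.X : PowerSeries R) ^ n ∣
      G - (pathMap k a b₁ b₂ c)^[n] 0 := by
    intro n
    rw [PowerSeries.X_pow_dvd_iff]
    intro i hi
    have := (PowerSeries.X_pow_dvd_iff.mp (hstep (i + 1) n hi)) i (Nat.lt_succ_self i)
    rw [map_sub, sub_eq_zero] at this
    rw [map_sub, PowerSeries.coeff_mk, this, sub_self]
  have hGG : IsPathGF k a b₁ b₂ c G := by
    refine ext0 _ _ fun n => ?_
    have h1 := hc _ _ _ (hG n)
    rw [← Function.iterate_succ_apply' (pathMap k a b₁ b₂ c)] at h1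
    have h2 := dvd_sub (hG (n + 1)) h1
    rw [sub_sub_sub_cancel_right] at h2
    exact (pow_dvd_pow _ (Nat.le_succ n)).trans h2
  refine ⟨G, hGG, ?_⟩
  · intro G' hG'
    refine ext0 _ _ fun n => ?_
    induction n with
    | zero => simp
    | succ n ih =>
      have := hc _ _ _ ih
      rwa [← hG', ← hGG] at this

/-- The sign `λ₁`: it is `1` if `k ≡ 0, 1 (mod 4)`, and `(-1)^n` if `k ≡ 2, 3 (mod 4)`. -/
def signLam1 (k n : ℕ) : ℤ :=
  if k % 4 = 0 ∨ k % 4 = 1 then 1 else (-1) ^ n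

/-- The sign `λ₂ = -λ₁`. -/
def signLam2 (k n : ℕ) : ℤ := -signLam1 k n

/-- The sign `μ₁`: it is `1` if `k ≡ 0, 1 (mod 4)`, and `(-1)^n` if `k ≡ 2, 3 (mod 4)`. -/
def signMu1 (k n : ℕ) : ℤ :=
  if k % 4 = 0 ∨ k % 4 = 1 then 1 else (-1) ^ n

/-- The sign `μ₂`: it is `1` if `k ≡ 0, 1 (mod 4)`, it is `(-1)^(n+k+1)` if `k ≡ 2 (mod 4)`,
and `(-1)^(n+k)` if `k ≡ 3 (mod 4)`. -/
def signMu2 (k n : ℕ) : ℤ :=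
  if k % 4 = 0 ∨ k % 4 = 1 then 1
  else if k % 4 = 2 then (-1) ^ (n + k + 1) else (-1) ^ (n + k)

/-! Keep G fixed and let t vary in F_t = a / (1 + b₁x + tx² + cx^k G), so that G = F_t at t = b₂.
The engine is `hankelDet_fraction`: if F = v x^d / D with D = P - x^(d+2) G', congruence by the
unitriangular Toeplitz matrix of D makes the Hankel matrix of F block diagonal, with an
antitriangular block of size d+1 and v times the Hankel matrix of G'.

Four such steps, with d = 0, 0, k-4, 0, remove 1 + 1 + (k-3) + 1 = k rows and lead from F_t to
F_(b₂+t), the defining equation of G being used in the last two. Hence H_(n+k)(F_t) is a signed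
monomial in a, c times H_n(F_(b₂+t)). The third step starts from a series divisible by x^(k-4),
which gives the zeros; stopping just after it gives H_(k-1)(F_t).

The steps divide by a and t, but the resulting identities are polynomial: `hankelReduction` proves
them for indeterminates and specialises. Iterating n times from t = b₂ reaches t = (n+1)b₂, the
source of the factor n+1. -/

/-! ### Toeplitz congruence and the Hankel determinants of a fraction. -/

theorem sum_congr_entry_succ {R : Type*} [CommRing R] (D F : ℕ → R) (i j : ℕ) :
    (∑ p ∈ Finset.range (i + 1), ∑ q ∈ Finset.range (j + 2),
        D (i - p) * D (j + 1 - q) * F (p + q)) =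
      (∑ p ∈ Finset.range (i + 1), ∑ q ∈ Finset.range (j + 1),
        D (i - p) * D (j - q) * F (p + q + 1))
      + D (j + 1) * ∑ p ∈ Finset.range (i + 1), D (i - p) * F p := by
  simp_rw [Finset.sum_range_succ' _ (j + 1)]
  rw [Finset.sum_add_distrib, Finset.mul_sum]
  congr 1
  · refine Finset.sum_congr rfl fun p _ => Finset.sum_congr rfl fun q _ => ?_
    rw [Nat.add_sub_add_right, add_assoc]
  · refine Finset.sum_congr rfl fun p _ => ?_
    simp; ring

/-- The `(i, j)` entry of `L H Lᵀ`, where `L` is the lower triangular Toeplitz matrix of `D`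
and `H` the Hankel matrix of `F`. -/
def toeplitzHankelEntry {R : Type*} [CommRing R] (D F : ℕ → R) (i j : ℕ) : R :=
  ∑ p ∈ Finset.range (i + 1), ∑ q ∈ Finset.range (j + 1), D (i - p) * D (j - q) * F (p + q)

theorem toeplitzHankelEntry_comm {R : Type*} [CommRing R] (D F : ℕ → R) (i j : ℕ) :
    toeplitzHankelEntry D F i j = toeplitzHankelEntry D F j i := by
  unfold toeplitzHankelEntry
  rw [Finset.sum_comm]
  refine Finset.sum_congr rfl fun p _ => Finset.sum_congr rfl fun q _ => ?_
  rw [add_comm q p]; ring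

/-- Splitting off the zero index leaves the same sum over `F (p + q + 1)` on both sides; only
boundary terms, which are coefficients of the product F D, differ. -/
theorem toeplitzHankelEntry_succ {R : Type*} [CommRing R] (D F : ℕ → R) (i j : ℕ) :
    toeplitzHankelEntry D F i (j + 1) = toeplitzHankelEntry D F (i + 1) j
      + D (j + 1) * (∑ p ∈ Finset.range (i + 1), D (i - p) * F p)
      - D (i + 1) * (∑ p ∈ Finset.range (j + 1), D (j - p) * F p) := by
  rw [toeplitzHankelEntry_comm D F (i + 1) j]
  unfold toeplitzHankelEntry
  rw [sum_congr_entry_succ, sum_congr_entry_succ, Finset.sum_comm]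
  have : (∑ y ∈ Finset.range (j + 1), ∑ x ∈ Finset.range (i + 1),
      D (i - x) * D (j - y) * F (x + y + 1)) =
      ∑ p ∈ Finset.range (j + 1), ∑ q ∈ Finset.range (i + 1),
        D (j - p) * D (i - q) * F (p + q + 1) := by
    refine Finset.sum_congr rfl fun p _ => Finset.sum_congr rfl fun q _ => ?_
    rw [add_comm q p]; ring
  rw [this]; ring

theorem coeff_mul_eq_sum_range {R : Type*} [CommRing R] (F D : PowerSeries R) (i : ℕ) :
    (∑ p ∈ Finset.range (i + 1), PowerSeries.coeff (i - p) D * PowerSeries.coeff p F)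
      = PowerSeries.coeff i (F * D) := by
  rw [PowerSeries.coeff_mul, Finset.Nat.sum_antidiagonal_eq_sum_range_succ
    (fun p q => PowerSeries.coeff p F * PowerSeries.coeff q D)]
  exact Finset.sum_congr rfl fun p _ => mul_comm _ _

/-- Since F D is a monomial, the boundary terms in `toeplitzHankelEntry_succ` vanish unless an index
equals d. Entries are therefore constant along antidiagonals except for jumps at row or column d,
which separate the two blocks. -/
theorem toeplitzHankelEntry_eq {R : Type*} [CommRing R] (F D G P : PowerSeries R) (v : R) (d : ℕ)
    (hF : F * D = PowerSeries.C v * PowerSeries.X ^ d) (hD0 : PowerSeries.coeff 0 D = 1)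
    (hD : D = P - PowerSeries.X ^ (d + 2) * G)
    (hP : ∀ m, d + 2 ≤ m → PowerSeries.coeff m P = 0) (i j : ℕ) :
    toeplitzHankelEntry (fun m => PowerSeries.coeff m D) (fun m => PowerSeries.coeff m F) i j =
      if i ≤ d then (if j ≤ d ∧ d ≤ i + j then v * PowerSeries.coeff (i + j - d) D else 0)
      else if j ≤ d then 0 else v * PowerSeries.coeff (i - (d + 1) + (j - (d + 1))) G := by
  have hFD : ∀ i, PowerSeries.coeff i (F * D) = if i = d then v else 0 := by
    intro i
    rw [hF, PowerSeries.coeff_C_mul, PowerSeries.coeff_X_pow]; simp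
  have hDG : ∀ m, PowerSeries.coeff (m + (d + 2)) D = - PowerSeries.coeff m G := by
    intro m
    rw [hD, map_sub, hP _ (by omega), PowerSeries.coeff_X_pow_mul, zero_sub]
  induction j generalizing i with
  | zero =>
    have h0 : toeplitzHankelEntry (fun m => PowerSeries.coeff m D)
        (fun m => PowerSeries.coeff m F) i 0 = if i = d then v else 0 := by
      rw [← hFD, ← coeff_mul_eq_sum_range]
      simp only [toeplitzHankelEntry, zero_add, Finset.sum_range_one, Nat.sub_self, hD0, mul_one,
        add_zero]
    rw [h0]
    rcases lt_trichotomy i d with h | h | h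
    · simp [h.ne, h.le, h]
    · subst h; simp [hD0]
    · simp [h.ne', h]
  | succ j ih =>
    rw [toeplitzHankelEntry_succ, ih, coeff_mul_eq_sum_range, coeff_mul_eq_sum_range, hFD, hFD]
    rcases lt_trichotomy i d with hi | hi | hi <;> rcases lt_trichotomy j d with hj | hj | hj
    · have e : i + 1 + j - d = i + (j + 1) - d := by omega
      simp only [hi.ne, hj.ne, hi.le, Nat.succ_le_of_lt hi, Nat.succ_le_of_lt hj, hj.le, e,
        if_true, if_false, true_and, mul_zero, add_zero, sub_zero]
      have : (d ≤ i + 1 + j) = (d ≤ i + (j + 1)) := by rw [eq_iff_iff]; omega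
      simp only [this]
    · subst hj
      have e : i + 1 + j - j = i + 1 := by omega
      simp [hi.ne, hi.le, Nat.succ_le_of_lt hi, e, mul_comm v]
    · simp [hi.ne, hj.ne', hi.le, Nat.succ_le_of_lt hi, hj.not_ge, show ¬ (j + 1 ≤ d) by omega]
    · subst hi
      have e : i + (j + 1) - i = j + 1 := by omega
      simp [hj.ne, hj.le, Nat.succ_le_of_lt hj, e, mul_comm v]
    · subst hi; subst hj; simp
    · subst hi
      -- The jump `v * coeff (j + 1) D` cancels the entry of the G-block, because beyond degree d +
      -- 1 the coefficients of D are those of -G.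
      obtain ⟨m, rfl⟩ : ∃ m, j = i + 1 + m := ⟨j - (i + 1), by omega⟩
      have := hDG m
      rw [show m + (i + 2) = i + 1 + m + 1 by ring] at this
      simp [this, show ¬ (i + 1 + m ≤ i) by omega, show ¬ (i + 1 + m + 1 ≤ i) by omega,
        show ¬ (i + 1 + m = i) by omega, mul_comm v]
    · simp [hi.ne', hj.ne, hi.not_ge, hj.le, Nat.succ_le_of_lt hj, show ¬ (i + 1 ≤ d) by omega]
    · subst hj
      obtain ⟨m, rfl⟩ : ∃ m, i = j + 1 + m := ⟨i - (j + 1), by omega⟩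
      have := hDG m
      rw [show m + (j + 2) = j + 1 + m + 1 by ring] at this
      simp [this, show ¬ (j + 1 + m ≤ j) by omega, show ¬ (j + 1 + m + 1 ≤ j) by omega,
        show ¬ (j + 1 + m = j) by omega, mul_comm v]
    · have e : i + 1 - (d + 1) + (j - (d + 1)) = i - (d + 1) + (j + 1 - (d + 1)) := by omega
      simp only [hi.ne', hj.ne', hi.not_ge, hj.not_ge, show ¬ (i + 1 ≤ d) by omega,
        show ¬ (j + 1 ≤ d) by omega, if_false, e, mul_zero, add_zero, sub_zero]

theorem neg_one_pow_triangle_succ {R : Type*} [CommRing R] (d : ℕ) :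
    (-1 : R) ^ ((d + 1) * (d + 1 + 1) / 2) = (-1) ^ (d + 1) * (-1) ^ (d * (d + 1) / 2) := by
  rw [← pow_add]
  congr 1
  rw [show (d + 1) * (d + 1 + 1) = d * (d + 1) + (d + 1) * 2 by ring,
    Nat.add_mul_div_right _ _ (by norm_num), add_comm]

/-- The first row has at most one nonzero entry, its last, and the corresponding minor has the same
shape. -/
theorem det_antitriangular {R : Type*} [CommRing R] (p : ℕ → R) (d : ℕ) :
    Matrix.det (Matrix.of fun i j : Fin (d + 1) =>
      if d ≤ (i : ℕ) + j then p ((i : ℕ) + j - d) else 0) =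
      (-1) ^ (d * (d + 1) / 2) * p 0 ^ (d + 1) := by
  induction d with
  | zero => simp
  | succ d ih =>
    rw [Matrix.det_succ_row_zero, Finset.sum_eq_single (Fin.last (d + 1))]
    · have e : (Matrix.of fun i j : Fin (d + 1 + 1) =>
          if d + 1 ≤ (i : ℕ) + j then p ((i : ℕ) + j - (d + 1)) else 0).submatrix Fin.succ
            (Fin.last (d + 1)).succAbove = Matrix.of fun i j : Fin (d + 1) =>
          if d ≤ (i : ℕ) + j then p ((i : ℕ) + j - d) else 0 := by
        ext i j
        have h1 : (i : ℕ) + 1 + j - (d + 1) = i + j - d := by omega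
        have h2 : (d < (i : ℕ) + 1 + j) = (d ≤ (i : ℕ) + j) := by rw [eq_iff_iff]; omega
        simp [h1, h2]
      rw [e, ih, neg_one_pow_triangle_succ]
      simp; ring
    · intro b _ hb
      have : ¬ (d < (b : ℕ)) := fun h => hb (Fin.ext (by simp; omega))
      simp [this]
    · simp

theorem hankelDet_toeplitz_congr {R : Type*} [CommRing R] (F D : PowerSeries R)
    (hD0 : PowerSeries.coeff 0 D = 1) (N : ℕ) :
    hankelDet F N = Matrix.det (Matrix.of fun i j : Fin N => toeplitzHankelEntry
      (fun m => PowerSeries.coeff m D) (fun m => PowerSeries.coeff m F) i j) := by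
  let L : Matrix (Fin N) (Fin N) R := Matrix.of fun i j =>
    if (j : ℕ) ≤ i then PowerSeries.coeff ((i : ℕ) - j) D else 0
  have hL : L.det = 1 := by
    rw [Matrix.det_of_isLowerTriangular]
    · simp [L, hD0]
    · intro i j hij
      have : i < j := hij
      simp [L, this.not_ge]
  have hsum : ∀ (i : Fin N) (f : ℕ → R), (∑ p : Fin N, L i p * f p)
      = ∑ p ∈ Finset.range ((i : ℕ) + 1), PowerSeries.coeff ((i : ℕ) - p) D * f p := by
    intro i f
    simp only [L, Matrix.of_apply]
    rw [Fin.sum_univ_eq_sum_range (fun p => (if p ≤ (i : ℕ) then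
      PowerSeries.coeff ((i : ℕ) - p) D else 0) * f p) N]
    symm
    rw [← Finset.sum_subset (Finset.range_subset_range.2 (Nat.succ_le_of_lt i.2))]
    · refine Finset.sum_congr rfl fun p hp => ?_
      rw [Finset.mem_range] at hp
      rw [if_pos (by omega)]
    · intro p _ hp
      rw [Finset.mem_range] at hp
      rw [if_neg (by omega), zero_mul]
  have hmul : (Matrix.of fun i j : Fin N => toeplitzHankelEntry
      (fun m => PowerSeries.coeff m D) (fun m => PowerSeries.coeff m F) i j)
      = L * (Matrix.of fun i j : Fin N => PowerSeries.coeff ((i : ℕ) + (j : ℕ)) F)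
          * L.transpose := by
    ext i j
    rw [Matrix.mul_assoc, Matrix.mul_apply]
    simp only [Matrix.mul_apply, Matrix.transpose_apply, Matrix.of_apply]
    have h1 : ∀ p : Fin N, (∑ q : Fin N, PowerSeries.coeff ((p : ℕ) + q) F * L j q)
        = ∑ q ∈ Finset.range ((j : ℕ) + 1),
          PowerSeries.coeff ((j : ℕ) - q) D * PowerSeries.coeff ((p : ℕ) + q) F := by
      intro p
      rw [← hsum j fun q => PowerSeries.coeff ((p : ℕ) + q) F]
      exact Finset.sum_congr rfl fun q _ => mul_comm _ _
    simp only [h1]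
    rw [hsum i fun p => ∑ q ∈ Finset.range ((j : ℕ) + 1),
          PowerSeries.coeff ((j : ℕ) - q) D * PowerSeries.coeff ((p : ℕ) + q) F]
    unfold toeplitzHankelEntry
    refine Finset.sum_congr rfl fun p _ => ?_
    rw [Finset.mul_sum]
    exact Finset.sum_congr rfl fun q _ => mul_assoc _ _ _
  rw [hmul, Matrix.det_mul, Matrix.det_mul, Matrix.det_transpose, hL, one_mul, mul_one, hankelDet]

/-- If `F = v x^d / (P - x^(d+2) G)` with `P` a polynomial of degree at most `d + 1` and constant
term `1`, then the Hankel determinants of `F` are those of `G` up to a shift and a monomial. -/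
theorem hankelDet_fraction {R : Type*} [CommRing R] (F D G P : PowerSeries R) (v : R) (d n : ℕ)
    (hF : F * D = PowerSeries.C v * PowerSeries.X ^ d) (hD0 : PowerSeries.coeff 0 D = 1)
    (hD : D = P - PowerSeries.X ^ (d + 2) * G)
    (hP : ∀ m, d + 2 ≤ m → PowerSeries.coeff m P = 0) :
    hankelDet F (n + d + 1)
      = (-1) ^ (d * (d + 1) / 2) * v ^ (n + d + 1) * hankelDet G n := by
  rw [show n + d + 1 = d + 1 + n by ring, hankelDet_toeplitz_congr F D hD0,
    ← Matrix.det_submatrix_equiv_self (finSumFinEquiv (m := d + 1) (n := n))]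
  have e : (Matrix.of fun i j : Fin (d + 1 + n) => toeplitzHankelEntry
      (fun m => PowerSeries.coeff m D) (fun m => PowerSeries.coeff m F) i j).submatrix
        finSumFinEquiv finSumFinEquiv = Matrix.fromBlocks
      (v • Matrix.of fun i j : Fin (d + 1) =>
        if d ≤ (i : ℕ) + j then PowerSeries.coeff ((i : ℕ) + j - d) D else 0) 0 0
      (v • Matrix.of fun i j : Fin n => PowerSeries.coeff ((i : ℕ) + (j : ℕ)) G) := by
    ext i j
    rcases i with i | i <;> rcases j with j | j <;>
      simp only [Matrix.submatrix_apply, Matrix.of_apply, finSumFinEquiv_apply_left,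
        finSumFinEquiv_apply_right, toeplitzHankelEntry_eq F D G P v d hF hD0 hD hP,
        Fin.val_castAdd, Fin.val_natAdd, Matrix.fromBlocks_apply₁₁, Matrix.fromBlocks_apply₁₂,
        Matrix.fromBlocks_apply₂₁, Matrix.fromBlocks_apply₂₂, Matrix.smul_apply,
        Matrix.zero_apply, smul_eq_mul]
    · have hi : (i : ℕ) ≤ d := by omega
      have hj : (j : ℕ) ≤ d := by omega
      simp [hi, hj]
    · have hi : (i : ℕ) ≤ d := by omega
      rw [if_pos hi, if_neg (by omega)]
    · rw [if_neg (by omega), if_pos (by omega)]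
    · rw [if_neg (by omega), if_neg (by omega), Nat.add_sub_cancel_left, Nat.add_sub_cancel_left]
  rw [e, Matrix.det_fromBlocks_zero₂₁, Matrix.det_smul, Matrix.det_smul,
    det_antitriangular (fun m => PowerSeries.coeff m D), hD0, hankelDet]
  simp
  ring

/-! ### Scaling, base change and small cases. -/

theorem hankelDet_C_mul {R : Type*} [CommRing R] (s : R) (F : PowerSeries R) (n : ℕ) :
    hankelDet (PowerSeries.C s * F) n = s ^ n * hankelDet F n := by
  have : (Matrix.of fun i j : Fin n => PowerSeries.coeff ((i : ℕ) + (j : ℕ))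
      (PowerSeries.C s * F)) = s • Matrix.of fun i j : Fin n =>
        PowerSeries.coeff ((i : ℕ) + (j : ℕ)) F := by
    ext i j; simp
  rw [hankelDet, this, Matrix.det_smul, Fintype.card_fin, hankelDet]

theorem hankelDet_map {R S : Type*} [CommRing R] [CommRing S] (φ : R →+* S) (F : PowerSeries R)
    (n : ℕ) : hankelDet (PowerSeries.map φ F) n = φ (hankelDet F n) := by
  rw [hankelDet, hankelDet, RingHom.map_det]
  congr 1

theorem hankelDet_X_pow_mul {R : Type*} [CommRing R] (F : PowerSeries R) (l n : ℕ)
    (hn : 1 ≤ n) (hl : n ≤ l) : hankelDet (PowerSeries.X ^ l * F) n = 0 := by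
  refine Matrix.det_eq_zero_of_row_eq_zero ⟨0, hn⟩ fun j => ?_
  rw [Matrix.of_apply, PowerSeries.coeff_X_pow_mul', if_neg]
  simp; omega

theorem hankelDet_zero {R : Type*} [CommRing R] (F : PowerSeries R) : hankelDet F 0 = 1 := by
  simp [hankelDet]

theorem hankelDet_one {R : Type*} [CommRing R] (F : PowerSeries R) :
    hankelDet F 1 = PowerSeries.coeff 0 F := by
  simp [hankelDet]

theorem mul_pathDenom_eq_iff {R : Type*} [CommRing R] (k : ℕ) (hk : 1 ≤ k) (a b₁ b₂ c : R)
    (G F : PowerSeries R) :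
    F = pathMap k a b₁ b₂ c G ↔ F * pathDenom k b₁ b₂ c G = PowerSeries.C a := by
  have h := pathDenom_mul_inv k hk b₁ b₂ c G
  unfold pathMap
  constructor
  · intro hF
    rw [hF]
    linear_combination PowerSeries.C a * h
  · intro hF
    rw [← hF, mul_assoc, h, mul_one]

theorem pathMap_mul_pathDenom {R : Type*} [CommRing R] (k : ℕ) (hk : 1 ≤ k) (a b₁ b₂ c : R)
    (G : PowerSeries R) :
    pathMap k a b₁ b₂ c G * pathDenom k b₁ b₂ c G = PowerSeries.C a :=
  (mul_pathDenom_eq_iff k hk a b₁ b₂ c G _).1 rfl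

theorem coeff_zero_pathDenom {R : Type*} [CommRing R] (k : ℕ) (hk : 1 ≤ k) (b₁ b₂ c : R)
    (G : PowerSeries R) : PowerSeries.coeff 0 (pathDenom k b₁ b₂ c G) = 1 := by
  simp [pathDenom, show k ≠ 0 by omega]

theorem coeff_zero_pathMap {R : Type*} [CommRing R] (k : ℕ) (a b₁ b₂ c : R)
    (G : PowerSeries R) : PowerSeries.coeff 0 (pathMap k a b₁ b₂ c G) = a := by
  simp [pathMap]

theorem map_pathDenom {R S : Type*} [CommRing R] [CommRing S] (φ : R →+* S) (k : ℕ)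
    (b₁ b₂ c : R) (G : PowerSeries R) :
    PowerSeries.map φ (pathDenom k b₁ b₂ c G)
      = pathDenom k (φ b₁) (φ b₂) (φ c) (PowerSeries.map φ G) := by
  simp [pathDenom]

theorem map_pathMap {R S : Type*} [CommRing R] [CommRing S] (φ : R →+* S) (k : ℕ) (hk : 1 ≤ k)
    (a b₁ b₂ c : R) (G : PowerSeries R) :
    PowerSeries.map φ (pathMap k a b₁ b₂ c G)
      = pathMap k (φ a) (φ b₁) (φ b₂) (φ c) (PowerSeries.map φ G) := by
  rw [mul_pathDenom_eq_iff k hk, ← map_pathDenom, ← map_mul, pathMap_mul_pathDenom k hk,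
    PowerSeries.map_C]

theorem IsPathGF.map {R S : Type*} [CommRing R] [CommRing S] {k : ℕ} (hk : 1 ≤ k) (φ : R →+* S)
    {a b₁ b₂ c : R} {G : PowerSeries R} (hG : IsPathGF k a b₁ b₂ c G) :
    IsPathGF k (φ a) (φ b₁) (φ b₂) (φ c) (PowerSeries.map φ G) := by
  have h := congrArg (PowerSeries.map φ) hG
  rwa [map_pathMap φ _ hk] at h

theorem hankelDet_map_pathMap {R S : Type*} [CommRing R] [CommRing S] (k : ℕ) (hk : 1 ≤ k)
    (φ : R →+* S) (a b₁ b₂ c : R) (G : PowerSeries R) (n : ℕ) :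
    hankelDet (pathMap k (φ a) (φ b₁) (φ b₂) (φ c) (PowerSeries.map φ G)) n
      = φ (hankelDet (pathMap k a b₁ b₂ c G) n) := by
  rw [← map_pathMap φ _ hk, hankelDet_map]

/-! ### The four fraction steps, with k = l + 4. -/

theorem hankelDet_pathMap_succ {R : Type*} [CommRing R] (l : ℕ) (a b₁ t c : R)
    (G : PowerSeries R) (n : ℕ) :
    hankelDet (pathMap (l + 4) a b₁ t c G) (n + 1) = a ^ (n + 1) *
      hankelDet (-(PowerSeries.C t + PowerSeries.C c * PowerSeries.X ^ (l + 2) * G)) n := by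
  have := hankelDet_fraction (pathMap (l + 4) a b₁ t c G) (pathDenom (l + 4) b₁ t c G)
    (-(PowerSeries.C t + PowerSeries.C c * PowerSeries.X ^ (l + 2) * G))
    (1 + PowerSeries.C b₁ * PowerSeries.X) a 0 n
    (by rw [pathMap_mul_pathDenom _ (by omega), pow_zero, mul_one])
    (coeff_zero_pathDenom _ (by omega) _ _ _ _)
    (by unfold pathDenom; ring)
    (by
      intro m hm
      obtain ⟨m, rfl⟩ : ∃ r, m = r + 2 := ⟨m - 2, by omega⟩
      simp [PowerSeries.coeff_one])
  simpa using this

/-- The Hankel determinants of `v (1 + e x^(l+2) G)`. -/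
theorem hankelDet_C_mul_one_add {R : Type*} [CommRing R] (l : ℕ) (v e : R)
    (G I : PowerSeries R)
    (hI : (1 + PowerSeries.C e * PowerSeries.X ^ (l + 2) * G) * I = 1) (n : ℕ) :
    hankelDet (PowerSeries.C v * (1 + PowerSeries.C e * PowerSeries.X ^ (l + 2) * G)) (n + 1)
      = v ^ (n + 1) * hankelDet (PowerSeries.X ^ l * (PowerSeries.C e * G * I)) n := by
  -- The series is v / I, and its inverse factor I has the shape required with d = 0 and P = 1.
  have h1 : I = 1 - PowerSeries.X ^ (0 + 2) *
      (PowerSeries.X ^ l * (PowerSeries.C e * G * I)) := by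
    linear_combination hI
  have := hankelDet_fraction
    (PowerSeries.C v * (1 + PowerSeries.C e * PowerSeries.X ^ (l + 2) * G)) I
    (PowerSeries.X ^ l * (PowerSeries.C e * G * I)) 1 v 0 n
    (by rw [mul_assoc, hI]; simp) (by rw [h1]; simp) h1
    (by
      intro m hm
      rw [PowerSeries.coeff_one, if_neg (by omega)])
  simpa using this

theorem exists_mul_eq_one_of_X_pow {R : Type*} [CommRing R] (l : ℕ) (e : R)
    (G : PowerSeries R) : ∃ I : PowerSeries R,
      (1 + PowerSeries.C e * PowerSeries.X ^ (l + 2) * G) * I = 1 :=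
  ⟨_, PowerSeries.mul_invOfUnit _ 1 (by simp)⟩

theorem hankelDet_pathMap_add_two {K : Type*} [Field K] (l : ℕ) (a b₁ t c : K) (ht : t ≠ 0)
    (G I : PowerSeries K)
    (hI : (1 + PowerSeries.C (c / t) * PowerSeries.X ^ (l + 2) * G) * I = 1) (n : ℕ) :
    hankelDet (pathMap (l + 4) a b₁ t c G) (n + 2) = a ^ (n + 2) * (-t) ^ (n + 1) *
      hankelDet (PowerSeries.X ^ l * (PowerSeries.C (c / t) * G * I)) n := by
  have hC : PowerSeries.C c = PowerSeries.C t * PowerSeries.C (c / t) := by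
    rw [← map_mul, mul_div_cancel₀ _ ht]
  have e : -(PowerSeries.C t + PowerSeries.C c * PowerSeries.X ^ (l + 2) * G)
      = PowerSeries.C (-t) * (1 + PowerSeries.C (c / t) * PowerSeries.X ^ (l + 2) * G) := by
    rw [hC, map_neg]; ring
  rw [hankelDet_pathMap_succ, e, hankelDet_C_mul_one_add l _ _ _ I hI]
  ring

/-- The equation for G rewrites the series as (ac/t) x^l over the product of `pathDenom` and 1 +
(c/t) x^(l+2) G. Applied again, it replaces G times `pathDenom` by a in the expanded product. -/
theorem hankelDet_inner_quotient {K : Type*} [Field K] (l : ℕ) (hl : 1 ≤ l) (a b₁ b₂ t c : K)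
    (G I : PowerSeries K) (hG : IsPathGF (l + 4) a b₁ b₂ c G)
    (hI : (1 + PowerSeries.C (c / t) * PowerSeries.X ^ (l + 2) * G) * I = 1) (n : ℕ) :
    hankelDet (PowerSeries.X ^ l * (PowerSeries.C (c / t) * G * I)) (n + l + 1)
      = (-1) ^ (l * (l + 1) / 2) * (a * c / t) ^ (n + l + 1) *
        hankelDet (-(PowerSeries.C (a * c / t) + PowerSeries.C c * PowerSeries.X ^ 2 * G)) n := by
  rw [isPathGF_iff _ (by omega)] at hG
  have hac : PowerSeries.C (a * c / t) = PowerSeries.C a * PowerSeries.C (c / t) := by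
    rw [← map_mul, mul_div_assoc]
  refine hankelDet_fraction _
    (pathDenom (l + 4) b₁ b₂ c G * (1 + PowerSeries.C (c / t) * PowerSeries.X ^ (l + 2) * G)) _
    (1 + PowerSeries.C b₁ * PowerSeries.X + PowerSeries.C b₂ * PowerSeries.X ^ 2) _ l n ?_ ?_ ?_ ?_
  · rw [hac]
    linear_combination PowerSeries.X ^ l * PowerSeries.C (c / t) * hG +
      PowerSeries.X ^ l * PowerSeries.C (c / t) * G * pathDenom (l + 4) b₁ b₂ c G * hI
  · simp [pathDenom]
  · rw [hac]
    have : pathDenom (l + 4) b₁ b₂ c G = 1 + PowerSeries.C b₁ * PowerSeries.X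
      + PowerSeries.C b₂ * PowerSeries.X ^ 2
      + PowerSeries.C c * PowerSeries.X ^ (l + 4) * G := rfl
    linear_combination PowerSeries.C (c / t) * PowerSeries.X ^ (l + 2) * hG + this
  · intro m hm
    -- The polynomial part has degree at most 2, which must not exceed l + 1: this is where k ≥ 5
    -- enters.
    obtain ⟨m, rfl⟩ : ∃ r, m = r + 3 := ⟨m - 3, by omega⟩
    simp [PowerSeries.coeff_one, PowerSeries.coeff_X_pow]

theorem hankelDet_inner_succ {K : Type*} [Field K] (k : ℕ) (hk : 1 ≤ k) (a b₁ b₂ t c : K)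
    (ha : a ≠ 0) (ht : t ≠ 0) (G : PowerSeries K) (hG : IsPathGF k a b₁ b₂ c G) (n : ℕ) :
    hankelDet (-(PowerSeries.C (a * c / t) + PowerSeries.C c * PowerSeries.X ^ 2 * G)) (n + 1)
      = (-(a * c / t)) ^ (n + 1) * (t / a) ^ n *
        hankelDet (pathMap k a b₁ (b₂ + t) c G) n := by
  rw [isPathGF_iff _ hk] at hG
  obtain ⟨I, hI⟩ := exists_mul_eq_one_of_X_pow 0 (t / a) G
  have hC : PowerSeries.C c = PowerSeries.C (a * c / t) * PowerSeries.C (t / a) := by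
    rw [← map_mul]
    congr 1
    field_simp
  have hta : PowerSeries.C t = PowerSeries.C a * PowerSeries.C (t / a) := by
    rw [← map_mul, mul_div_cancel₀ _ ha]
  have e : -(PowerSeries.C (a * c / t) + PowerSeries.C c * PowerSeries.X ^ 2 * G)
      = PowerSeries.C (-(a * c / t)) * (1 + PowerSeries.C (t / a) * PowerSeries.X ^ (0 + 2) * G) := by
    rw [hC, map_neg]; ring
  -- Multiplying `pathDenom` by 1 + (t/a) x² G adds exactly t x², since G times `pathDenom` is a;
  -- thus the parameter b₂ becomes b₂ + t.
  have hF : G * I = pathMap k a b₁ (b₂ + t) c G := by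
    rw [mul_pathDenom_eq_iff k hk]
    have h1 : pathDenom k b₁ (b₂ + t) c G
        = pathDenom k b₁ b₂ c G + PowerSeries.C t * PowerSeries.X ^ 2 := by
      simp only [pathDenom, map_add]; ring
    rw [h1, hta]
    linear_combination I * hG + PowerSeries.C a * hI
  rw [e, hankelDet_C_mul_one_add 0 _ _ _ I hI, pow_zero, one_mul, mul_assoc, hF, hankelDet_C_mul,
    mul_assoc]

/-! ### The reduction by k, over a field and then over any commutative ring. -/

/-- The relations that reduce the Hankel determinants of `a / (1 + b₁ x + t x² + c x^k G)` to
those of `a / (1 + b₁ x + (b₂ + t) x² + c x^k G)`, for `k = l + 4`. -/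
structure HankelReduction {R : Type*} [CommRing R] (l : ℕ) (a b₁ b₂ t c : R)
    (G : PowerSeries R) : Prop where
  shift : ∀ n, hankelDet (pathMap (l + 4) a b₁ t c G) (n + (l + 4)) =
    (-1) ^ (l + l * (l + 1) / 2) * a ^ (2 * n + 2 * l + 7) * c ^ (2 * n + l + 3) *
      hankelDet (pathMap (l + 4) a b₁ (b₂ + t) c G) n
  vanish : ∀ j, 1 ≤ j → j ≤ l → hankelDet (pathMap (l + 4) a b₁ t c G) (j + 2) = 0
  last : hankelDet (pathMap (l + 4) a b₁ t c G) (l + 3) =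
    (-1) ^ (l + l * (l + 1) / 2) * t * a ^ (2 * l + 4) * c ^ (l + 1)

theorem hankelReduction_field {K : Type*} [Field K] (l : ℕ) (hl : 1 ≤ l) (a b₁ b₂ t c : K)
    (ha : a ≠ 0) (ht : t ≠ 0) (G : PowerSeries K) (hG : IsPathGF (l + 4) a b₁ b₂ c G) :
    HankelReduction l a b₁ b₂ t c G := by
  obtain ⟨I, hI⟩ := exists_mul_eq_one_of_X_pow l (c / t) G
  have h2 := hankelDet_pathMap_add_two l a b₁ t c ht G I hI
  have h3 := hankelDet_inner_quotient l hl a b₁ b₂ t c G I hG hI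
  refine ⟨fun n => ?_, fun j hj hjl => ?_, ?_⟩
  · rw [show n + (l + 4) = n + 1 + l + 1 + 2 by ring, h2, h3,
      hankelDet_inner_succ (l + 4) (by omega) a b₁ b₂ t c ha ht G hG]
    rw [neg_pow t, neg_pow (a * c / t), div_pow, div_pow, div_pow, mul_pow, mul_pow]
    -- The signs come from the powers of -t and of -(ac/t).
    have s : (-1 : K) ^ (n + 1 + l + 1 + 1) * (-1) ^ (n + 1) = (-1) ^ l := by
      rw [← pow_add, show n + 1 + l + 1 + 1 + (n + 1) = l + 2 * (n + 2) by ring, pow_add,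
        pow_mul]
      simp
    rw [pow_add (-1 : K) l, ← s]
    field_simp
    ring
  · rw [h2, hankelDet_X_pow_mul _ _ _ hj hjl, mul_zero]
  · rw [show l + 3 = 0 + l + 1 + 2 by ring, h2, h3, hankelDet_zero, neg_pow t, div_pow, mul_pow]
    have s : (-1 : K) ^ (0 + l + 1 + 1) = (-1) ^ l := by
      rw [show 0 + l + 1 + 1 = l + 2 by ring, pow_add]; simp
    rw [s, pow_add (-1 : K) l]
    field_simp
    ring

/-- In the fraction field of ℤ[a, b₁, b₂, t, c] the divisions are legitimate. Injectivity brings the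
identities down to the polynomial ring, and evaluation carries them to R; uniqueness of the solution
identifies the image of the universal series with G. -/
theorem hankelReduction {R : Type*} [CommRing R] (l : ℕ) (hl : 1 ≤ l) (a b₁ b₂ t c : R)
    (G : PowerSeries R) (hG : IsPathGF (l + 4) a b₁ b₂ c G) :
    HankelReduction l a b₁ b₂ t c G := by
  have hk : 1 ≤ l + 4 := by omega
  let S := MvPolynomial (Fin 5) ℤ
  let Y : Fin 5 → S := MvPolynomial.X
  let ι : S →+* FractionRing S := algebraMap S (FractionRing S)
  have hι : Function.Injective ι := IsFractionRing.injective S (FractionRing S)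
  obtain ⟨U, hU, -⟩ := existsUnique_isPathGF (l + 4) hk (Y 0) (Y 1) (Y 2) (Y 4)
  have hne : ∀ i, ι (Y i) ≠ 0 := fun i =>
    (map_ne_zero_iff ι hι).2 (MvPolynomial.X_ne_zero i)
  have hfield := hankelReduction_field l hl _ _ _ _ _ (hne 0) (hne 3) _ (IsPathGF.map hk ι hU)
  have hdet := fun s n => hankelDet_map_pathMap (l + 4) hk ι (Y 0) (Y 1) s (Y 4) U n
  have huniv : HankelReduction l (Y 0) (Y 1) (Y 2) (Y 3) (Y 4) U := by
    refine ⟨fun n => hι ?_, fun j hj hjl => hι ?_, hι ?_⟩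
    · have := hfield.shift n
      rw [← map_add, hdet, hdet] at this
      simpa using this
    · have := hfield.vanish j hj hjl
      rw [hdet] at this
      simpa using this
    · have := hfield.last
      rw [hdet] at this
      simpa using this
  let φ : S →+* R := MvPolynomial.eval₂Hom (Int.castRingHom R) ![a, b₁, b₂, t, c]
  have h0 : φ (Y 0) = a := MvPolynomial.eval₂_X _ _ _
  have h1 : φ (Y 1) = b₁ := MvPolynomial.eval₂_X _ _ _
  have h2 : φ (Y 2) = b₂ := MvPolynomial.eval₂_X _ _ _
  have h3 : φ (Y 3) = t := MvPolynomial.eval₂_X _ _ _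
  have h4 : φ (Y 4) = c := MvPolynomial.eval₂_X _ _ _
  have hUG : PowerSeries.map φ U = G := by
    have := IsPathGF.map hk φ hU
    rw [h0, h1, h2, h4] at this
    exact (existsUnique_isPathGF (l + 4) hk a b₁ b₂ c).unique this hG
  have hdetR : ∀ s n, φ (hankelDet (pathMap (l + 4) (Y 0) (Y 1) s (Y 4) U) n)
      = hankelDet (pathMap (l + 4) a b₁ (φ s) c G) n := by
    intro s n
    rw [← hankelDet_map_pathMap _ hk, h0, h1, h4, hUG]
  refine ⟨fun n => ?_, fun j hj hjl => ?_, ?_⟩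
  · have := congrArg φ (huniv.shift n)
    simpa only [map_mul, map_pow, map_neg, map_one, map_add, hdetR, h0, h2, h3, h4] using this
  · have := congrArg φ (huniv.vanish j hj hjl)
    simpa only [hdetR, h3, map_zero] using this
  · have := congrArg φ huniv.last
    simpa only [map_mul, map_pow, map_neg, map_one, hdetR, h0, h3, h4] using this

/-! ### Iteration of the reduction, signs and conclusion. -/

theorem hankelDet_pathMap_two {R : Type*} [CommRing R] (l : ℕ) (a b₁ t c : R)
    (G : PowerSeries R) :
    hankelDet (pathMap (l + 4) a b₁ t c G) 2 = -(t * a ^ 2) := by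
  rw [show 2 = 1 + 1 from rfl, hankelDet_pathMap_succ, hankelDet_one]
  simp; ring

theorem hankelDet_pathMap_mul_add {R : Type*} [CommRing R] (l : ℕ) (hl : 1 ≤ l)
    (a b₁ b₂ c : R) (G : PowerSeries R) (hG : IsPathGF (l + 4) a b₁ b₂ c G) (n j : ℕ) (t : R) :
    hankelDet (pathMap (l + 4) a b₁ t c G) ((l + 4) * n + j) =
      ((-1) ^ (l + l * (l + 1) / 2)) ^ n
        * a ^ ((l + 4) * n * (n - 1) + (2 * j + 2 * l + 7) * n)
        * c ^ ((l + 4) * n * (n - 1) + (2 * j + l + 3) * n)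
        * hankelDet (pathMap (l + 4) a b₁ (n * b₂ + t) c G) j := by
  induction n generalizing t with
  | zero => simp
  | succ n ih =>
    rw [show (l + 4) * (n + 1) + j = (l + 4) * n + j + (l + 4) by ring,
      (hankelReduction l hl a b₁ b₂ t c G hG).shift, ih]
    -- The case split handles the truncated `n - 1`, which is harmless at n = 0 because of the
    -- factor n.
    have e1 : 2 * ((l + 4) * n + j) + 2 * l + 7
        + ((l + 4) * n * (n - 1) + (2 * j + 2 * l + 7) * n)
        = (l + 4) * (n + 1) * n + (2 * j + 2 * l + 7) * (n + 1) := by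
      cases n with
      | zero => ring
      | succ n => rw [Nat.add_sub_cancel]; ring
    have e2 : 2 * ((l + 4) * n + j) + l + 3
        + ((l + 4) * n * (n - 1) + (2 * j + l + 3) * n)
        = (l + 4) * (n + 1) * n + (2 * j + l + 3) * (n + 1) := by
      cases n with
      | zero => ring
      | succ n => rw [Nat.add_sub_cancel]; ring
    have e3 : ((n + 1 : ℕ) : R) * b₂ + t = n * b₂ + (b₂ + t) := by push_cast; ring
    rw [Nat.add_sub_cancel, ← e1, ← e2, e3, pow_add a, pow_add c]
    ring

theorem neg_one_pow_add_triangle {R : Type*} [CommRing R] (l : ℕ) :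
    (-1 : R) ^ (l + l * (l + 1) / 2) = if l % 4 = 0 ∨ l % 4 = 1 then 1 else -1 := by
  -- Writing l = 4q + r, the triangular number of l differs from that of r by an even number, so
  -- only r matters.
  have hq : l * (l + 1) / 2 = (l / 4) * (2 * l + 2 * (l % 4) + 2) + l % 4 * (l % 4 + 1) / 2 := by
    rw [← Nat.mul_add_div (by norm_num)]
    congr 1
    conv_lhs => rw [← Nat.div_add_mod l 4]
    conv_rhs => rw [show 2 * l = 2 * (4 * (l / 4) + l % 4) by rw [Nat.div_add_mod]]
    ring
  have he : Even ((l / 4) * (2 * l + 2 * (l % 4) + 2)) :=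
    Even.mul_left ⟨l + l % 4 + 1, by ring⟩ _
  rw [hq, add_left_comm, pow_add, he.neg_one_pow, one_mul]
  have h4 : l % 4 < 4 := Nat.mod_lt _ (by norm_num)
  interval_cases h : l % 4
  · simpa using Even.neg_one_pow (Nat.even_iff.2 (by omega))
  · simpa using Even.neg_one_pow (Nat.even_iff.2 (by omega))
  · simpa using Odd.neg_one_pow (Nat.odd_iff.2 (by omega))
  · simpa using Odd.neg_one_pow (Nat.odd_iff.2 (by omega))

theorem neg_one_pow_signMu1 {R : Type*} [CommRing R] (l n : ℕ) :
    ((-1 : R) ^ (l + l * (l + 1) / 2)) ^ n = (signMu1 (l + 4) n : R) := by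
  rw [neg_one_pow_add_triangle, signMu1, Nat.add_mod_right]
  split_ifs <;> simp

theorem neg_one_pow_signMu2 {R : Type*} [CommRing R] (l n : ℕ) :
    ((-1 : R) ^ (l + l * (l + 1) / 2)) ^ n * (-1 : R) ^ (l + l * (l + 1) / 2)
      = (signMu2 (l + 4) n : R) := by
  rw [neg_one_pow_add_triangle, signMu2, Nat.add_mod_right]
  split_ifs with h1 h2
  · simp
  · have h : Even (l + 4) := Nat.even_iff.2 (by omega)
    push_cast
    rw [add_right_comm, pow_add _ (n + 1), h.neg_one_pow, mul_one, pow_succ]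
  · have h : Odd (l + 4) := Nat.odd_iff.2 (by omega)
    push_cast
    rw [pow_add, h.neg_one_pow]

theorem theorem3 {R : Type*} [CommRing R] (k : ℕ) (hk : 5 ≤ k) (a b₁ b₂ c : R)
    (G : PowerSeries R) (hG : IsPathGF k a b₁ b₂ c G) (n : ℕ) :
    hankelDet G (k * n)
        = (signMu1 k n : R) * a ^ (k * n * (n - 1) + (2 * k - 1) * n)
            * c ^ (k * n * (n - 1) + (k - 1) * n)
    ∧ hankelDet G (k * n + 1)
        = (signLam1 k n : R) * a ^ (k * n * (n + 1) + n + 1)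
            * c ^ (k * n * (n + 1) - (k - 1) * n)
    ∧ hankelDet G (k * n + 2)
        = (signLam2 k n : R) * ((n : R) + 1) * b₂ * a ^ (k * n * (n + 1) + 3 * n + 2)
            * c ^ (k * n * (n + 1) - (k - 3) * n)
    ∧ (∀ j : ℕ, 3 ≤ j → j ≤ k - 2 → hankelDet G (k * n + j) = 0)
    ∧ hankelDet G (k * n + k - 1)
        = (signMu2 k n : R) * ((n : R) + 1) * b₂
            * a ^ (k * n * (n + 1) + (2 * k - 3) * n + (2 * k - 4))
            * c ^ (k * n * (n + 1) + (k - 3) * n + (k - 3)) := by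
  obtain ⟨l, rfl⟩ : ∃ l, k = l + 4 := ⟨k - 4, by omega⟩
  have hl : 1 ≤ l := by omega
  have key := fun j => hankelDet_pathMap_mul_add l hl a b₁ b₂ c G hG n j b₂
  rw [← show G = pathMap (l + 4) a b₁ b₂ c G from hG] at key
  simp only [neg_one_pow_signMu1] at key
  -- After n reductions the parameter is n b₂ + b₂; the remaining indices below k are read off
  -- there.
  have hred := hankelReduction l hl a b₁ b₂ (n * b₂ + b₂) c G hG
  have hdbl : (l + 4) * n * (n - 1) + (l + 4) * n + (l + 4) * n = (l + 4) * n * (n + 1) := by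
    cases n with
    | zero => ring
    | succ n => rw [Nat.add_sub_cancel]; ring
  refine ⟨?_, ?_, ?_, fun j hj hjl => ?_, ?_⟩
  · have := key 0
    rw [hankelDet_zero, mul_one, add_zero] at this
    rw [this, show 2 * (l + 4) - 1 = 2 * 0 + 2 * l + 7 by omega,
      show l + 4 - 1 = 2 * 0 + l + 3 by omega]
  · have e1 : (l + 4) * n * (n + 1) + n + 1
        = (l + 4) * n * (n - 1) + (2 * 1 + 2 * l + 7) * n + 1 := by
      rw [← hdbl]; ring
    have h : (l + 3) * n ≤ (l + 4) * n * (n + 1) :=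
      (Nat.mul_le_mul_right n (by omega)).trans (Nat.le_mul_of_pos_right _ n.succ_pos)
    have e2 : (l + 4) * n * (n + 1) - (l + 4 - 1) * n
        = (l + 4) * n * (n - 1) + (2 * 1 + l + 3) * n := by
      rw [show l + 4 - 1 = l + 3 by omega, Nat.sub_eq_iff_eq_add h, ← hdbl]; ring
    rw [key 1, hankelDet_one, coeff_zero_pathMap, e1, e2, pow_succ a,
      show signLam1 (l + 4) n = signMu1 (l + 4) n from rfl]
    ring
  · have e1 : (l + 4) * n * (n + 1) + 3 * n + 2
        = (l + 4) * n * (n - 1) + (2 * 2 + 2 * l + 7) * n + 2 := by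
      rw [← hdbl]; ring
    have h : (l + 1) * n ≤ (l + 4) * n * (n + 1) :=
      (Nat.mul_le_mul_right n (by omega)).trans (Nat.le_mul_of_pos_right _ n.succ_pos)
    have e2 : (l + 4) * n * (n + 1) - (l + 4 - 3) * n
        = (l + 4) * n * (n - 1) + (2 * 2 + l + 3) * n := by
      rw [show l + 4 - 3 = l + 1 by omega, Nat.sub_eq_iff_eq_add h, ← hdbl]; ring
    rw [key 2, hankelDet_pathMap_two, e1, e2, pow_add a _ 2, signLam2,
      show signLam1 (l + 4) n = signMu1 (l + 4) n from rfl]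
    push_cast
    ring
  · obtain ⟨i, rfl⟩ : ∃ i, j = i + 2 := ⟨j - 2, by omega⟩
    rw [key, hred.vanish i (by omega) (by omega), mul_zero]
  · have e1 : (l + 4) * n * (n + 1) + (2 * (l + 4) - 3) * n + (2 * (l + 4) - 4)
        = (l + 4) * n * (n - 1) + (2 * (l + 3) + 2 * l + 7) * n + (2 * l + 4) := by
      rw [← hdbl, show 2 * (l + 4) - 3 = 2 * l + 5 by omega,
        show 2 * (l + 4) - 4 = 2 * l + 4 by omega]; ring
    have e2 : (l + 4) * n * (n + 1) + (l + 4 - 3) * n + (l + 4 - 3)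
        = (l + 4) * n * (n - 1) + (2 * (l + 3) + l + 3) * n + (l + 1) := by
      rw [← hdbl, show l + 4 - 3 = l + 1 by omega]; ring
    rw [show (l + 4) * n + (l + 4) - 1 = (l + 4) * n + (l + 3) by omega, key, hred.last, e1, e2,
      ← neg_one_pow_signMu2, ← neg_one_pow_signMu1, pow_add a _ (2 * l + 4), pow_add c _ (l + 1)]
    ring
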